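/- Let $m\ge 0$, let $\mathbb R^m$ carry the standard inner product, and let $C_b(\mathbb R^m)$ be the C*-algebra of bounded continuous functions $\mathbb R^m\to\mathbb C$ with the supremum norm $\|\cdot\|_\infty$. Let $C_{\mathcal R}(\mathbb R^m)$, the commutative resolvent algebra, be the C*-subalgebra of $C_b(\mathbb R^m)$ generated by the functions $h_x^\lambda(y)=1/(i\lambda-x\cdot y)$ with $x\in\mathbb R^m$ and $\lambda\in\mathbb R\setminus\{0\}$. For a linear subspace $V\subseteq\mathbb R^m$ let $P_V:\mathbb R^m\to V$ be the orthogonal projection onto $V$; its nullity is $\operatorname{nul}P_V=m-\dim V$. For $0\le r\le m$ define $C_r(\mathbb R^m)\subseteq C_b(\mathbb R^m)$ inductively: $C_0(\mathbb R^m)$ is the space of continuous functions vanishing at infinity; and for $1\le r\le m$, $C_r(\mathbb R^m)$ is the set of all $f\in C_b(\mathbb R^m)$ for which there are a countable (possibly finite or empty) family of distinct subspaces $V_i\subseteq\mathbb R^m$ with $\operatorname{nul}P_{V_i}=r$ and functions $g_i\in C_0(V_i)$ (continuous $V_i\to\mathbb C$, vanishing at infinity) such that $$[f]_{r-1}=\sum_i\,[g_i\circ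 P_{V_i}]_{r-1}$$ with unconditional convergence in the quotient $C_b(\mathbb R^m)/C_{r-1}(\mathbb R^m)$, whose topology is that of the seminorm $\|[f]_{r-1}\|=\inf_{\xi\in C_{r-1}(\mathbb R^m)}\|f-\xi\|_\infty$. (Each $C_r(\mathbb R^m)$ is a vector space.) Then $$C_{\mathcal R}(\mathbb R^m)=C_m(\mathbb R^m),$$ and $C_0(\mathbb R^m)\subsetneq C_1(\mathbb R^m)\subsetneq\dots\subsetneq C_m(\mathbb R^m)$ is a chain of closed ideals in $C_{\mathcal R}(\mathbb R^m)$. -/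

import Mathlib

open Topology
open scoped BoundedContinuousFunction ZeroAtInfty

noncomputable section

namespace CommResolvent

section General

variable {X : Type*} [NormedAddCommGroup X] [InnerProductSpace ℝ X]

theorem resolvent_denom_ne_zero {lam : ℝ} (hlam : lam ≠ 0) (t : ℝ) :
    Complex.I * (lam : ℂ) - (t : ℂ) ≠ 0 := by
  intro h
  have := congrArg Complex.im h
  simp at this
  exact hlam this

theorem resolvent_norm_le {lam : ℝ} (hlam : lam ≠ 0) (t : ℝ) :
    ‖1 / (Complex.I * (lam : ℂ) - (t : ℂ))‖ ≤ 1 / |lam| := by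
  rw [norm_div, norm_one]
  apply one_div_le_one_div_of_le (abs_pos.mpr hlam)
  simpa using Complex.abs_im_le_norm (Complex.I * (lam : ℂ) - (t : ℂ))

/-- The classical resolvent `h_x^lam : y ↦ 1 / (i lam - x ⬝ y)` (with `lam ≠ 0`),
a bounded continuous function on `X`. -/
def resolventFun (lam : ℝ) (hlam : lam ≠ 0) (x : X) : X →ᵇ ℂ :=
  BoundedContinuousFunction.ofNormedAddCommGroup
    (fun y : X => 1 / (Complex.I * (lam : ℂ) - ((inner ℝ x y : ℝ) : ℂ)))
    (by
      refine Continuous.div continuous_const (by fun_prop) ?_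
      intro y
      exact resolvent_denom_ne_zero hlam _)
    (1 / |lam|) (fun y => resolvent_norm_le hlam _)

/-- The unit is `i` times the resolvent with `lam = 1`, `x = 0`; so the C⋆-subalgebra generated by
the resolvents contains the unit, and it is the same to generate it as a unital algebra. -/
theorem I_smul_resolventFun_one_zero :
    Complex.I • resolventFun 1 one_ne_zero (0 : X) = 1 := by
  ext y
  simp [resolventFun]

variable (X) in
/-- The commutative resolvent algebra: the C⋆-subalgebra of `C_b(X)` generated by
the functions `h_x^lam`, `lam ≠ 0`, `x ∈ X`. -/
def commResolventAlgebra : StarSubalgebra ℂ (X →ᵇ ℂ) :=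
  (StarAlgebra.adjoin ℂ
    {f : X →ᵇ ℂ | ∃ (lam : ℝ) (hlam : lam ≠ 0) (x : X), f = resolventFun lam hlam x}
    ).topologicalClosure

/-- The levee `g ∘ P_V`, where `P_V` is the orthogonal projection of `X` onto the
finite-dimensional subspace `V` and `g ∈ C₀(V)`. -/
def levee (V : Submodule ℝ X) [FiniteDimensional ℝ V] (g : C₀(V, ℂ)) : X →ᵇ ℂ :=
  g.toBCF.compContinuous ⟨fun y => V.orthogonalProjectionOnto y, V.orthogonalProjectionOnto.continuous⟩

end General

/-- `ℝ^m` with its Euclidean inner product. -/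
abbrev E (m : ℕ) : Type := EuclideanSpace ℝ (Fin m)

/-- The bounded continuous functions on `ℝ^m` which vanish at infinity. -/
def vanishing (m : ℕ) : Submodule ℂ (E m →ᵇ ℂ) where
  carrier := {f | Filter.Tendsto f (Filter.cocompact (E m)) (𝓝 0)}
  zero_mem' := by
    exact (tendsto_const_nhds : Filter.Tendsto (fun _ : E m => (0 : ℂ)) _ _)
  add_mem' := by
    intro a b ha hb
    have h := Filter.Tendsto.add ha hb
    rw [add_zero] at h
    exact h
  smul_mem' := by
    intro c a ha
    have h := Filter.Tendsto.const_smul ha c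
    rw [smul_zero] at h
    exact h

/-- The relation `[f] = ∑_{V ∈ S} [g_V ∘ P_V]` in `C_b(ℝ^m) / N` for some countable set `S` of
subspaces of nullity `k` (that is, of dimension `m - k`) and some `g_V ∈ C₀(V)`, `V ∈ S`.
The quotient carries the quotient seminorm `‖[f]‖ = inf_{ξ ∈ N} ‖f - ξ‖`, and the sum
converges unconditionally. -/
def IsLeveeSumMod (m k : ℕ) (N : Submodule ℂ (E m →ᵇ ℂ)) (f : E m →ᵇ ℂ) : Prop :=
  ∃ (S : Set (Submodule ℝ (E m))) (g : (V : Submodule ℝ (E m)) → C₀(V, ℂ)),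
    S.Countable ∧ (∀ V ∈ S, Module.finrank ℝ V + k = m) ∧
    HasSum (fun V : S => (N.mkQ (levee (V : Submodule ℝ (E m)) (g V)) : (E m →ᵇ ℂ) ⧸ N))
      (N.mkQ f)

theorem levee_add {m : ℕ} (V : Submodule ℝ (E m)) (g h : C₀(V, ℂ)) :
    levee V (g + h) = levee V g + levee V h := rfl

theorem levee_smul {m : ℕ} (V : Submodule ℝ (E m)) (c : ℂ) (g : C₀(V, ℂ)) :
    levee V (c • g) = c • levee V g := rfl

theorem levee_zero {m : ℕ} (V : Submodule ℝ (E m)) : levee V (0 : C₀(V, ℂ)) = 0 := rfl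

theorem IsLeveeSumMod.zero (m k : ℕ) (N : Submodule ℂ (E m →ᵇ ℂ)) : IsLeveeSumMod m k N 0 := by
  refine ⟨∅, fun V => 0, Set.countable_empty, by simp, ?_⟩
  rw [map_zero]
  exact hasSum_empty

theorem IsLeveeSumMod.smul {m k : ℕ} {N : Submodule ℂ (E m →ᵇ ℂ)} (c : ℂ) {f : E m →ᵇ ℂ}
    (hf : IsLeveeSumMod m k N f) : IsLeveeSumMod m k N (c • f) := by
  obtain ⟨S, g, hS, hd, h⟩ := hf
  refine ⟨S, fun V => c • g V, hS, hd, ?_⟩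
  simp only [levee_smul, map_smul]
  exact h.const_smul c

open Classical in
theorem IsLeveeSumMod.add {m k : ℕ} {N : Submodule ℂ (E m →ᵇ ℂ)} {f₁ f₂ : E m →ᵇ ℂ}
    (h₁ : IsLeveeSumMod m k N f₁) (h₂ : IsLeveeSumMod m k N f₂) :
    IsLeveeSumMod m k N (f₁ + f₂) := by
  obtain ⟨S, g, hS, hSd, hg⟩ := h₁
  obtain ⟨T, u, hT, hTd, hu⟩ := h₂
  refine ⟨S ∪ T, fun V => (if V ∈ S then g V else 0) + (if V ∈ T then u V else 0),
    hS.union hT, fun V hV => hV.elim (hSd V) (hTd V), ?_⟩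
  have hg' := (hasSum_subtype_iff_indicator (s := S)
    (f := fun V : Submodule ℝ (E m) => N.mkQ (levee V (g V)))).1 hg
  have hu' := (hasSum_subtype_iff_indicator (s := T)
    (f := fun V : Submodule ℝ (E m) => N.mkQ (levee V (u V)))).1 hu
  refine (hasSum_subtype_iff_indicator (s := S ∪ T)
    (f := fun V : Submodule ℝ (E m) => N.mkQ (levee V
      ((if V ∈ S then g V else 0) + (if V ∈ T then u V else 0))))).2 ?_
  rw [map_add]
  convert hg'.add hu' using 1
  funext V
  by_cases h1 : V ∈ S <;> by_cases h2 : V ∈ T <;>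
    simp [h1, h2, levee_add, levee_zero]

/-- The spaces `C_r(ℝ^m)` (of interest for `0 ≤ r ≤ m`): `C_0(ℝ^m)` consists of the continuous
functions vanishing at infinity, and `C_{r+1}(ℝ^m)` of the bounded continuous functions whose class
in `C_b(ℝ^m) / C_r(ℝ^m)` is a countable unconditional sum of classes of levees
`g_i ∘ P_i` with distinct projections `P_i` of nullity `r + 1`. -/
def C (m : ℕ) : ℕ → Submodule ℂ (E m →ᵇ ℂ)
  | 0 => vanishing m
  | r + 1 =>
    { carrier := {f | IsLeveeSumMod m (r + 1) (C m r) f}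
      zero_mem' := IsLeveeSumMod.zero m (r + 1) (C m r)
      add_mem' := fun h₁ h₂ => h₁.add h₂
      smul_mem' := fun c _ h => h.smul c }

end CommResolvent

end

open Topology
open scoped BoundedContinuousFunction ZeroAtInfty

noncomputable section

namespace CommResolvent

/-! ### Levees, their products, and their membership in the resolvent algebra -/

section Levees

variable {X : Type*} [NormedAddCommGroup X] [InnerProductSpace ℝ X]

/-! The proof replaces `C m r` by the closed span `nullityLevel m r` of all levees of nullity at
most `r`. The product of levees over `V` and `W` is a levee over `V ⊔ W`, so closed spans over
upward closed families of subspaces are ideals. Resolvents are levees over lines or over `⊥`, and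
Stone–Weierstrass puts every levee into the algebra; hence the algebra is the closed span of all
levees, which is the level `m`.

Two estimates identify the levels with the spaces `C m r`. From below (`norm_le_norm_levee_add`):
moving to infinity in a generic direction orthogonal to `V` fixes a levee over `V` and kills levees
over `W` not contained in `V`, so coefficients are controlled by the norm. From above
(`exists_norm_sum_levee_sub_le`): distinct subspaces of equal dimension have a larger join, so their
levees are orthogonal modulo the previous level, and a sum has quotient norm at most the largest
coefficient norm. The first makes the coefficients of approximants converge; the second makes the
limiting series converge unconditionally. The first also gives strictness of the chain. -/

theorem levee_apply (V : Submodule ℝ X) [FiniteDimensional ℝ V] (g : C₀(V, ℂ)) (y : X) :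
    levee V g y = g (V.orthogonalProjectionOnto y) := rfl

theorem levee_apply_coe (V : Submodule ℝ X) [FiniteDimensional ℝ V] (g : C₀(V, ℂ)) (v : V) :
    levee V g v = g v := by
  rw [levee_apply, Submodule.orthogonalProjectionOnto_mem_subspace_eq_self]

theorem norm_apply_le (V : Submodule ℝ X) (g : C₀(V, ℂ)) (v : V) : ‖g v‖ ≤ ‖g‖ :=
  g.toBCF.norm_coe_le_norm v

/-- If a point of `V ⊔ W` escapes to infinity, then so does one of its projections. -/
theorem tendsto_projections_sup (V W : Submodule ℝ X) [FiniteDimensional ℝ V]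
    [FiniteDimensional ℝ W] :
    Filter.Tendsto (fun u : (V ⊔ W : Submodule ℝ X) =>
      (V.orthogonalProjectionOnto (u : X), W.orthogonalProjectionOnto (u : X)))
      (Filter.cocompact _) (Filter.cocompact (V × W)) := by
  let T : (V ⊔ W : Submodule ℝ X) →ₗ[ℝ] V × W :=
    ((V.orthogonalProjectionOnto.prod W.orthogonalProjectionOnto).comp
      (V ⊔ W).subtypeL).toLinearMap
  -- An injective linear map from a finite-dimensional space is a closed embedding, hence proper. A
  -- kernel vector lies in `V ⊔ W` and is orthogonal to it.
  have hT : T.ker = ⊥ := by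
    rw [LinearMap.ker_eq_bot']
    intro u hu
    have h1 : V.orthogonalProjectionOnto (u : X) = 0 := congrArg Prod.fst hu
    have h2 : W.orthogonalProjectionOnto (u : X) = 0 := congrArg Prod.snd hu
    rw [Submodule.orthogonalProjectionOnto_eq_zero_iff] at h1 h2
    have h3 : (u : X) ∈ (V ⊔ W)ᗮ := by
      rw [← Submodule.inf_orthogonal]
      exact ⟨h1, h2⟩
    exact Subtype.ext ((Submodule.mem_bot ℝ).1
      ((Submodule.inf_orthogonal_eq_bot (V ⊔ W)).le ⟨u.2, h3⟩))
  exact (T.isClosedEmbedding_of_injective hT).tendsto_cocompact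

theorem tendsto_mul_cocompact_prod {α β : Type*} [TopologicalSpace α] [TopologicalSpace β]
    (g : C₀(α, ℂ)) (h : C₀(β, ℂ)) :
    Filter.Tendsto (fun p : α × β => g p.1 * h p.2) (Filter.cocompact (α × β)) (𝓝 0) := by
  rw [← Filter.coprod_cocompact, Filter.coprod, Filter.tendsto_sup]
  constructor
  · have h1 : Filter.Tendsto (fun p : α × β => g p.1)
        (Filter.comap Prod.fst (Filter.cocompact α)) (𝓝 0) :=
      g.zero_at_infty'.comp Filter.tendsto_comap
    exact h1.zero_mul_isBoundedUnder_le
      (Filter.isBoundedUnder_of ⟨‖h.toBCF‖, fun p => h.toBCF.norm_coe_le_norm p.2⟩)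
  · have h1 : Filter.Tendsto (fun p : α × β => h p.2)
        (Filter.comap Prod.snd (Filter.cocompact β)) (𝓝 0) :=
      h.zero_at_infty'.comp Filter.tendsto_comap
    exact Filter.isBoundedUnder_le_mul_tendsto_zero
      (Filter.isBoundedUnder_of ⟨‖g.toBCF‖, fun p : α × β => g.toBCF.norm_coe_le_norm p.1⟩) h1

/-- The product of the levees over `V` and `W` is a levee over `V ⊔ W`. -/
theorem exists_levee_mul (V W U : Submodule ℝ X) [FiniteDimensional ℝ V] [FiniteDimensional ℝ W]
    [FiniteDimensional ℝ U] (hU : V ⊔ W = U) (g : C₀(V, ℂ)) (h : C₀(W, ℂ)) :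
    ∃ k : C₀(U, ℂ), levee V g * levee W h = levee U k := by
  subst hU
  have hc : Continuous fun u : (V ⊔ W : Submodule ℝ X) =>
      g (V.orthogonalProjectionOnto (u : X)) * h (W.orthogonalProjectionOnto (u : X)) :=
    (g.continuous.comp (V.orthogonalProjectionOnto.continuous.comp continuous_subtype_val)).mul
      (h.continuous.comp (W.orthogonalProjectionOnto.continuous.comp continuous_subtype_val))
  have ht := (tendsto_mul_cocompact_prod g h).comp (tendsto_projections_sup V W)
  refine ⟨⟨⟨_, hc⟩, ht⟩, ?_⟩
  ext y
  -- Projecting first onto `V ⊔ W` changes neither factor.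
  have h1 := Submodule.orthogonalProjectionOnto_starProjection_of_le
    (le_sup_left : V ≤ V ⊔ W) y
  have h2 := Submodule.orthogonalProjectionOnto_starProjection_of_le
    (le_sup_right : W ≤ V ⊔ W) y
  rw [BoundedContinuousFunction.mul_apply, levee_apply, levee_apply, ← h1, ← h2]
  rfl

theorem tendsto_resolvent (lam : ℝ) :
    Filter.Tendsto (fun t : ℝ => 1 / (Complex.I * (lam : ℂ) - (t : ℂ))) (Filter.cocompact ℝ)
      (𝓝 0) := by
  simp only [one_div]
  refine Filter.tendsto_inv₀_cobounded.comp ?_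
  rw [← tendsto_norm_atTop_iff_cobounded]
  have h : Filter.Tendsto (fun t : ℝ => ‖t‖) (Filter.cocompact ℝ) Filter.atTop :=
    tendsto_norm_cocompact_atTop
  refine Filter.tendsto_atTop_mono (fun t => ?_) h
  simpa using Complex.abs_re_le_norm (Complex.I * (lam : ℂ) - (t : ℂ))

/-- The resolvent in direction `x` is a levee over the span of `x`. -/
theorem exists_resolventFun_eq_levee {lam : ℝ} (hlam : lam ≠ 0) (x : X) :
    ∃ k : C₀((Submodule.span ℝ {x} : Submodule ℝ X), ℂ),
      resolventFun lam hlam x = levee (Submodule.span ℝ {x}) k := by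
  let V : Submodule ℝ X := Submodule.span ℝ {x}
  have hx : x ∈ V := Submodule.mem_span_singleton_self x
  let T : V →ₗ[ℝ] ℝ := ((innerSL ℝ x).comp V.subtypeL).toLinearMap
  have hT : T.ker = ⊥ := by
    rw [LinearMap.ker_eq_bot']
    rintro ⟨u, hu⟩ h
    have h' : inner ℝ x u = 0 := h
    obtain ⟨c, rfl⟩ := Submodule.mem_span_singleton.1 hu
    rw [inner_smul_right, mul_eq_zero, inner_self_eq_zero] at h'
    rcases h' with rfl | rfl <;> simp
  refine ⟨⟨⟨fun u => 1 / (Complex.I * (lam : ℂ) - ((inner ℝ x (u : X) : ℝ) : ℂ)), ?_⟩,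
    (tendsto_resolvent lam).comp (T.isClosedEmbedding_of_injective hT).tendsto_cocompact⟩, ?_⟩
  · refine Continuous.div continuous_const (by fun_prop) ?_
    intro y
    exact resolvent_denom_ne_zero hlam _
  · ext y
    change 1 / (Complex.I * (lam : ℂ) - ((inner ℝ x y : ℝ) : ℂ)) =
      1 / (Complex.I * (lam : ℂ) - ((inner ℝ x (V.orthogonalProjectionOnto y : X) : ℝ) : ℂ))
    have := Submodule.inner_orthogonalProjectionOnto_eq_of_mem_left (K := V) ⟨x, hx⟩ y
    rw [← this]
    rfl

/-- Such products provide a nowhere vanishing function in `C₀(V)` that comes from the algebra; the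
empty product shows that the unit is a levee over `⊥`. -/
theorem exists_prod_resolventFun_eq_levee (s : Finset X) (V : Submodule ℝ X)
    [FiniteDimensional ℝ V] (hV : Submodule.span ℝ (s : Set X) = V) :
    ∃ k : C₀(V, ℂ), ∏ x ∈ s, resolventFun 1 one_ne_zero x = levee V k := by
  classical
  induction s using Finset.induction_on generalizing V with
  | empty =>
    have hb : V = ⊥ := by rw [← hV]; simp
    subst hb
    refine ⟨⟨1, ?_⟩, rfl⟩
    rw [Filter.cocompact_eq_bot]
    exact Filter.tendsto_bot
  | insert a s ha ih =>
    have hV' : Submodule.span ℝ {a} ⊔ Submodule.span ℝ (s : Set X) = V := by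
      rw [← hV, Finset.coe_insert, Submodule.span_insert]
    subst hV'
    obtain ⟨k, hk⟩ := ih _ rfl
    obtain ⟨l, hl⟩ := exists_resolventFun_eq_levee one_ne_zero a
    rw [Finset.prod_insert ha, hk, hl]
    exact exists_levee_mul _ _ _ rfl l k

theorem resolventFun_mem {lam : ℝ} (hlam : lam ≠ 0) (x : X) :
    resolventFun lam hlam x ∈ commResolventAlgebra X :=
  StarSubalgebra.le_topologicalClosure _ (StarAlgebra.subset_adjoin ℂ _ ⟨lam, hlam, x, rfl⟩)

/-- Restriction of a function on the one-point compactification of `V` to `V`, pulled back along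
the orthogonal projection. -/
def onePointPullback (V : Submodule ℝ X) [FiniteDimensional ℝ V] :
    C(OnePoint V, ℂ) →⋆ₐ[ℂ] (X →ᵇ ℂ) where
  toFun F := (BoundedContinuousFunction.mkOfCompact F).compContinuous
    ⟨fun y => (V.orthogonalProjectionOnto y : OnePoint V),
      OnePoint.continuous_coe.comp V.orthogonalProjectionOnto.continuous⟩
  map_one' := rfl
  map_mul' _ _ := rfl
  map_zero' := rfl
  map_add' _ _ := rfl
  commutes' _ := rfl
  map_star' _ := rfl

theorem continuous_onePointPullback (V : Submodule ℝ X) [FiniteDimensional ℝ V] :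
    Continuous (onePointPullback V) :=
  (BoundedContinuousFunction.continuous_compContinuous _).comp
    (ContinuousMap.isometryEquivBoundedOfCompact (OnePoint V) ℂ).continuous

/-- Extension by zero of a function vanishing at infinity to the one-point compactification. -/
def onePointExtend {V : Type*} [TopologicalSpace V] [T2Space V] (g : C₀(V, ℂ)) :
    C(OnePoint V, ℂ) :=
  OnePoint.continuousMapMk g.toContinuousMap 0
    (by rw [Filter.coclosedCompact_eq_cocompact]; exact g.zero_at_infty')

/-- Stone–Weierstrass on `OnePoint V`, for the closed subalgebra `B` of functions whose pullback
lies in the algebra. The nowhere vanishing `p` separates infinity from the points of `V`. -/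
theorem levee_mem_commResolventAlgebra (V : Submodule ℝ X) [FiniteDimensional ℝ V]
    (g : C₀(V, ℂ)) : levee V g ∈ commResolventAlgebra X := by
  let B : StarSubalgebra ℂ C(OnePoint V, ℂ) := (commResolventAlgebra X).comap (onePointPullback V)
  have hclosed : IsClosed (B : Set C(OnePoint V, ℂ)) :=
    (StarSubalgebra.isClosed_topologicalClosure _).preimage (continuous_onePointPullback V)
  obtain ⟨s, hs⟩ := Module.Finite.iff_fg.1 ‹FiniteDimensional ℝ V›
  obtain ⟨p, hp⟩ := exists_prod_resolventFun_eq_levee s V hs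
  have hpA : levee V p ∈ commResolventAlgebra X := by
    rw [← hp]
    exact prod_mem fun x _ => resolventFun_mem _ x
  have hp0 : ∀ v : V, p v ≠ 0 := by
    intro v
    rw [← levee_apply_coe, ← hp, BoundedContinuousFunction.coe_prod, Finset.prod_apply,
      Finset.prod_ne_zero_iff]
    exact fun x _ => one_div_ne_zero (resolvent_denom_ne_zero one_ne_zero _)
  have hpB : onePointExtend p ∈ B := hpA
  have hsep : B.SeparatesPoints := by
    intro a b hab
    induction a using OnePoint.rec with
    | infty =>
      induction b using OnePoint.rec with
      | infty => exact absurd rfl hab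
      | coe v => exact ⟨_, ⟨_, hpB, rfl⟩, (hp0 v).symm⟩
    | coe u =>
      induction b using OnePoint.rec with
      | infty => exact ⟨_, ⟨_, hpB, rfl⟩, hp0 u⟩
      | coe v =>
        by_cases hpuv : p u = p v
        -- The resolvent in direction `u - v` takes equal values at `u` and `v` only if `‖u - v‖² =
        -- 0`. The factor `p` turns it into a levee over all of `V`.
        · obtain ⟨l, hl⟩ := exists_resolventFun_eq_levee one_ne_zero ((u - v : V) : X)
          obtain ⟨q, hq⟩ : ∃ q : C₀(V, ℂ),
              levee V p * resolventFun 1 one_ne_zero ((u - v : V) : X) = levee V q := by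
            have hle : Submodule.span ℝ {((u - v : V) : X)} ≤ V := by
              rw [Submodule.span_singleton_le_iff_mem]
              exact (u - v).2
            rw [hl]
            exact exists_levee_mul V _ V (sup_eq_left.2 hle) p l
          have hqB : onePointExtend q ∈ B := by
            change levee V q ∈ commResolventAlgebra X
            rw [← hq]
            exact mul_mem hpA (resolventFun_mem _ _)
          refine ⟨_, ⟨_, hqB, rfl⟩, ?_⟩
          change q u ≠ q v
          rw [← levee_apply_coe, ← levee_apply_coe, ← hq]
          change levee V p u * (1 / _) ≠ levee V p v * (1 / _)
          rw [levee_apply_coe, levee_apply_coe, hpuv]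
          intro h
          have h1 := mul_left_cancel₀ (hp0 v) h
          rw [one_div, one_div, inv_inj, sub_right_inj, Complex.ofReal_inj, ← sub_eq_zero,
            ← inner_sub_right] at h1
          have h2 : (u - v : V) = 0 := Subtype.ext (inner_self_eq_zero.1 h1)
          exact hab (congrArg _ (sub_eq_zero.1 h2))
        · exact ⟨_, ⟨_, hpB, rfl⟩, hpuv⟩
  have htop := ContinuousMap.starSubalgebra_topologicalClosure_eq_top_of_separatesPoints B hsep
  have hB : onePointExtend g ∈ (B : Set C(OnePoint V, ℂ)) := by
    rw [← hclosed.closure_eq, ← StarSubalgebra.topologicalClosure_coe, htop]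
    trivial
  exact hB

end Levees

/-! ### Closed spans of levees, and translation to infinity -/

section Translations

variable {X : Type*} [NormedAddCommGroup X] [InnerProductSpace ℝ X] [FiniteDimensional ℝ X]

/-- The closed span of the levees over the subspaces satisfying `p`. -/
def leveeSpan (p : Submodule ℝ X → Prop) : Submodule ℂ (X →ᵇ ℂ) :=
  (Submodule.span ℂ {f | ∃ (V : Submodule ℝ X) (g : C₀(V, ℂ)), p V ∧ f = levee V g}
    ).topologicalClosure

theorem levee_mem_leveeSpan {p : Submodule ℝ X → Prop} {V : Submodule ℝ X} (hV : p V)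
    (g : C₀(V, ℂ)) : levee V g ∈ leveeSpan p :=
  Submodule.le_topologicalClosure _ (Submodule.subset_span ⟨V, g, hV, rfl⟩)

theorem isClosed_leveeSpan (p : Submodule ℝ X → Prop) :
    IsClosed (leveeSpan p : Set (X →ᵇ ℂ)) :=
  Submodule.isClosed_topologicalClosure _

theorem leveeSpan_le {p : Submodule ℝ X → Prop} {N : Submodule ℂ (X →ᵇ ℂ)}
    (hN : IsClosed (N : Set (X →ᵇ ℂ)))
    (h : ∀ (V : Submodule ℝ X) (g : C₀(V, ℂ)), p V → levee V g ∈ N) : leveeSpan p ≤ N := by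
  refine Submodule.topologicalClosure_minimal _ (Submodule.span_le.2 ?_) hN
  rintro f ⟨V, g, hV, rfl⟩
  exact h V g hV

theorem leveeSpan_mono {p q : Submodule ℝ X → Prop} (h : ∀ V, p V → q V) :
    leveeSpan p ≤ leveeSpan q :=
  leveeSpan_le (isClosed_leveeSpan q) fun V g hV => levee_mem_leveeSpan (h V hV) g

theorem tendsto_levee_line (V : Submodule ℝ X) (g : C₀(V, ℂ)) (v w : X)
    (hw : w ∉ Vᗮ) :
    Filter.Tendsto (fun t : ℝ => levee V g (v + t • w)) Filter.atTop (𝓝 0) := by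
  refine g.zero_at_infty'.comp ?_
  have hw' : V.orthogonalProjectionOnto w ≠ 0 := fun h =>
    hw (Submodule.orthogonalProjectionOnto_eq_zero_iff.1 h)
  have h1 : (fun t : ℝ => V.orthogonalProjectionOnto (v + t • w)) =
      fun t => V.orthogonalProjectionOnto v + t • V.orthogonalProjectionOnto w := by
    funext t
    rw [map_add, map_smul]
  change Filter.Tendsto (fun t : ℝ => V.orthogonalProjectionOnto (v + t • w)) _ _
  rw [h1, ← Metric.cobounded_eq_cocompact, ← tendsto_norm_atTop_iff_cobounded]
  have h2 : Filter.Tendsto (fun t : ℝ => t * ‖V.orthogonalProjectionOnto w‖ -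
      ‖V.orthogonalProjectionOnto v‖) Filter.atTop Filter.atTop :=
    Filter.tendsto_atTop_add_const_right _ _
      (Filter.tendsto_id.atTop_mul_const (norm_pos_iff.2 hw'))
  refine Filter.tendsto_atTop_mono' _ ?_ h2
  filter_upwards [Filter.eventually_ge_atTop 0] with t ht
  have h3 := norm_sub_norm_le (t • V.orthogonalProjectionOnto w) (-V.orthogonalProjectionOnto v)
  rwa [norm_neg, sub_neg_eq_add, add_comm (t • _), norm_smul, Real.norm_of_nonneg ht] at h3

/-- A finite combination of levees over subspaces not contained in `V` vanishes at infinity along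
generic directions orthogonal to `V`. -/
theorem exists_finset_tendsto_line (V : Submodule ℝ X) {f : X →ᵇ ℂ}
    (hf : f ∈ Submodule.span ℂ
      {f | ∃ (W : Submodule ℝ X) (g : C₀(W, ℂ)), ¬ W ≤ V ∧ f = levee W g}) :
    ∃ T : Set (Submodule ℝ X), T.Finite ∧ (∀ W ∈ T, ¬ W ≤ V) ∧
      ∀ w : X, (∀ W ∈ T, w ∉ Wᗮ) → ∀ v : X,
        Filter.Tendsto (fun t : ℝ => f (v + t • w)) Filter.atTop (𝓝 0) := by
  induction hf using Submodule.span_induction with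
  | mem f hf =>
    obtain ⟨W, g, hW, rfl⟩ := hf
    refine ⟨{W}, Set.finite_singleton W, by simpa using hW, fun w hw v => ?_⟩
    exact tendsto_levee_line W g v w (hw W rfl)
  | zero => exact ⟨∅, Set.finite_empty, by simp, fun w _ v => tendsto_const_nhds⟩
  | add f₁ f₂ _ _ h₁ h₂ =>
    obtain ⟨T₁, hT₁, hV₁, h₁⟩ := h₁
    obtain ⟨T₂, hT₂, hV₂, h₂⟩ := h₂
    refine ⟨T₁ ∪ T₂, hT₁.union hT₂, fun W hW => hW.elim (hV₁ W) (hV₂ W), fun w hw v => ?_⟩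
    have := (h₁ w (fun W hW => hw W (Or.inl hW)) v).add (h₂ w (fun W hW => hw W (Or.inr hW)) v)
    rwa [add_zero] at this
  | smul c f _ h =>
    obtain ⟨T, hT, hV, h⟩ := h
    refine ⟨T, hT, hV, fun w hw v => ?_⟩
    have := (h w hw v).const_smul c
    rwa [smul_zero] at this

/-- Each `Wᗮ` meets `Vᗮ` in a proper subspace, and a real vector space is not a finite union of
proper subspaces. -/
theorem exists_mem_orthogonal_forall_notMem (V : Submodule ℝ X) {T : Set (Submodule ℝ X)}
    (hT : T.Finite) (hV : ∀ W ∈ T, ¬ W ≤ V) : ∃ w ∈ Vᗮ, ∀ W ∈ T, w ∉ Wᗮ := by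
  have : Finite T := hT
  obtain ⟨w, hw⟩ := Submodule.exists_forall_notMem_of_forall_ne_top
    (fun W : T => (W : Submodule ℝ X)ᗮ.comap Vᗮ.subtype) (by
      rintro ⟨W, hW⟩ h
      rw [Submodule.comap_subtype_eq_top, Submodule.orthogonal_le_orthogonal_iff] at h
      exact hV W hW h)
  exact ⟨w, w.2, fun W hW => hw ⟨W, hW⟩⟩

/-- A levee over `V` keeps its norm modulo the levees over subspaces not contained in `V`. -/
theorem norm_le_norm_levee_add (V : Submodule ℝ X) (g : C₀(V, ℂ)) {f : X →ᵇ ℂ}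
    (hf : f ∈ leveeSpan fun W : Submodule ℝ X => ¬ W ≤ V) : ‖g‖ ≤ ‖levee V g + f‖ := by
  have hclosed : IsClosed {f : X →ᵇ ℂ | ‖g‖ ≤ ‖levee V g + f‖} :=
    isClosed_le continuous_const (by fun_prop)
  refine closure_minimal ?_ hclosed hf
  intro f hf
  obtain ⟨T, hT, hV, h⟩ := exists_finset_tendsto_line V hf
  obtain ⟨w, hwV, hw⟩ := exists_mem_orthogonal_forall_notMem V hT hV
  rw [Set.mem_ofPred_eq, ← ZeroAtInftyContinuousMap.norm_toBCF_eq_norm]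
  refine (BoundedContinuousFunction.norm_le (norm_nonneg _)).2 fun v => ?_
  -- Along `w` the levee over `V` is constant while `f` tends to zero, so `‖g v‖` is a limit of
  -- values bounded by the norm of the sum.
  have h1 : ∀ t : ℝ, levee V g ((v : X) + t • w) = g v := by
    intro t
    rw [levee_apply, map_add, map_smul, Submodule.orthogonalProjectionOnto_mem_subspace_eq_self,
      Submodule.orthogonalProjectionOnto_apply_of_mem_orthogonal hwV, smul_zero, add_zero]
  have h2 : Filter.Tendsto (fun t : ℝ => ‖(levee V g + f) ((v : X) + t • w)‖) Filter.atTop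
      (𝓝 ‖g v + 0‖) := by
    have : (fun t : ℝ => ‖(levee V g + f) ((v : X) + t • w)‖) =
        fun t => ‖g v + f ((v : X) + t • w)‖ := by
      funext t
      rw [BoundedContinuousFunction.add_apply, h1]
    rw [this]
    exact ((h w hw v).const_add _).norm
  rw [add_zero] at h2
  exact le_of_tendsto h2 (Filter.Eventually.of_forall fun t =>
    BoundedContinuousFunction.norm_coe_le_norm _ _)

theorem leveeSpan_mul_levee_mem {p : Submodule ℝ X → Prop} (hp : ∀ V W, V ≤ W → p V → p W)
    {f : X →ᵇ ℂ} (hf : f ∈ leveeSpan p) (W : Submodule ℝ X) (h : C₀(W, ℂ)) :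
    f * levee W h ∈ leveeSpan p := by
  refine leveeSpan_le (p := p) (N := (leveeSpan p).comap (LinearMap.mulRight ℂ (levee W h)))
    ((isClosed_leveeSpan p).preimage (continuous_mul_const _)) (fun V g hV => ?_) hf
  obtain ⟨k, hk⟩ := exists_levee_mul V W _ rfl g h
  change levee V g * levee W h ∈ leveeSpan p
  rw [hk]
  exact levee_mem_leveeSpan (hp _ _ le_sup_left hV) k

/-- The levee spans of upward closed families of subspaces are ideals. -/
theorem leveeSpan_mul_mem {p q : Submodule ℝ X → Prop} (hp : ∀ V W, V ≤ W → p V → p W)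
    {f h : X →ᵇ ℂ} (hf : f ∈ leveeSpan p) (hh : h ∈ leveeSpan q) :
    f * h ∈ leveeSpan p :=
  leveeSpan_le (N := (leveeSpan p).comap (LinearMap.mulLeft ℂ f))
    ((isClosed_leveeSpan p).preimage (continuous_const_mul _))
    (fun W g _ => leveeSpan_mul_levee_mem hp hf W g) hh

theorem star_mem_leveeSpan {p : Submodule ℝ X → Prop} {f : X →ᵇ ℂ} (hf : f ∈ leveeSpan p) :
    star f ∈ leveeSpan p := by
  refine leveeSpan_le (p := p)
    (N := { carrier := {f | star f ∈ leveeSpan p}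
            zero_mem' := by simp
            add_mem' := fun {a b} ha hb => by
              rw [Set.mem_ofPred_eq, star_add]; exact add_mem ha hb
            smul_mem' := fun c a ha => by
              rw [Set.mem_ofPred_eq, star_smul]; exact Submodule.smul_mem _ _ ha })
    ((isClosed_leveeSpan p).preimage continuous_star) (fun V g hV => ?_) hf
  exact levee_mem_leveeSpan hV (star g)

theorem one_mem_leveeSpan : (1 : X →ᵇ ℂ) ∈ leveeSpan fun _ : Submodule ℝ X => True := by
  obtain ⟨k, hk⟩ := exists_prod_resolventFun_eq_levee (∅ : Finset X) ⊥ (by simp)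
  rw [Finset.prod_empty] at hk
  rw [hk]
  exact levee_mem_leveeSpan trivial k

variable (X) in
/-- The commutative resolvent algebra is the closed span of all levees. -/
theorem coe_commResolventAlgebra :
    (commResolventAlgebra X : Set (X →ᵇ ℂ)) = leveeSpan fun _ : Submodule ℝ X => True := by
  apply Set.Subset.antisymm
  · let B : StarSubalgebra ℂ (X →ᵇ ℂ) :=
      { carrier := leveeSpan fun _ : Submodule ℝ X => True
        mul_mem' := fun ha hb => leveeSpan_mul_mem (fun _ _ _ _ => trivial) ha hb
        add_mem' := fun ha hb => add_mem ha hb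
        algebraMap_mem' := fun c => by
          rw [Algebra.algebraMap_eq_smul_one]
          exact Submodule.smul_mem _ c one_mem_leveeSpan
        star_mem' := fun ha => star_mem_leveeSpan ha }
    have h : commResolventAlgebra X ≤ B := by
      refine StarSubalgebra.topologicalClosure_minimal (StarAlgebra.adjoin_le ?_)
        (isClosed_leveeSpan _)
      rintro f ⟨lam, hlam, x, rfl⟩
      obtain ⟨k, hk⟩ := exists_resolventFun_eq_levee hlam x
      rw [hk]
      exact levee_mem_leveeSpan (p := fun _ => True) trivial k
    exact h
  · exact leveeSpan_le (N := (commResolventAlgebra X).toSubalgebra.toSubmodule)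
      (StarSubalgebra.isClosed_topologicalClosure _)
      (fun V g _ => levee_mem_commResolventAlgebra V g)

end Translations

/-! ### Almost orthogonality of levees over distinct subspaces -/

section Orthogonality

variable {X : Type*} [NormedAddCommGroup X] [InnerProductSpace ℝ X] [FiniteDimensional ℝ X]

/-- The function `min 1 (‖g‖ / ε)`: it vanishes at infinity and equals `1` where `ε ≤ ‖g‖`. -/
def cutoff {V : Type*} [TopologicalSpace V] (ε : ℝ) (g : C₀(V, ℂ)) : C₀(V, ℂ) where
  toFun v := ((min 1 (‖g v‖ / ε) : ℝ) : ℂ)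
  continuous_toFun := by fun_prop
  zero_at_infty' := by
    have h1 : Filter.Tendsto (fun v => g v) (Filter.cocompact V) (𝓝 0) := g.zero_at_infty'
    have h2 : Continuous fun z : ℂ => ((min 1 (‖z‖ / ε) : ℝ) : ℂ) := by fun_prop
    have h3 := (h2.tendsto 0).comp h1
    rw [norm_zero, zero_div, min_eq_right zero_le_one, Complex.ofReal_zero] at h3
    exact h3

theorem cutoff_apply_of_le {V : Type*} [TopologicalSpace V] {ε : ℝ} (hε : 0 < ε) (g : C₀(V, ℂ))
    {v : V} (hv : ε ≤ ‖g v‖) : cutoff ε g v = 1 := by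
  change ((min 1 (‖g v‖ / ε) : ℝ) : ℂ) = 1
  rw [min_eq_left ((one_le_div hε).2 hv), Complex.ofReal_one]

theorem norm_one_sub_cutoff_le {V : Type*} [TopologicalSpace V] {ε : ℝ} (hε : 0 < ε)
    (g : C₀(V, ℂ)) (v : V) : ‖1 - cutoff ε g v‖ ≤ 1 := by
  change ‖1 - ((min 1 (‖g v‖ / ε) : ℝ) : ℂ)‖ ≤ 1
  have h0 : 0 ≤ min 1 (‖g v‖ / ε) := le_min zero_le_one (by positivity)
  have h1 : min 1 (‖g v‖ / ε) ≤ 1 := min_le_left _ _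
  rw [← Complex.ofReal_one, ← Complex.ofReal_sub, Complex.norm_real, Real.norm_eq_abs, abs_le]
  constructor <;> linarith

/-- Each factor `1 - levee W (g W)` costs a term containing a levee over `V ⊔ W`, which lies in the
ideal. -/
theorem mul_prod_one_sub_levee_mem {p : Submodule ℝ X → Prop} (hp : ∀ V W, V ≤ W → p V → p W)
    {V : Submodule ℝ X} (f : C₀(V, ℂ)) (g : (W : Submodule ℝ X) → C₀(W, ℂ))
    (U : Finset (Submodule ℝ X)) (hU : ∀ W ∈ U, p (V ⊔ W)) :
    levee V f - levee V f * ∏ W ∈ U, (1 - levee W (g W)) ∈ leveeSpan p := by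
  classical
  induction U using Finset.induction_on with
  | empty => simp
  | insert W U hW ih =>
    rw [Finset.prod_insert hW]
    have h1 : levee V f - levee V f * ((1 - levee W (g W)) * ∏ W ∈ U, (1 - levee W (g W))) =
        (levee V f - levee V f * ∏ W ∈ U, (1 - levee W (g W))) +
          (levee V f * levee W (g W)) * ∏ W ∈ U, (1 - levee W (g W)) := by ring
    rw [h1]
    refine add_mem (ih fun W hW => hU W (Finset.mem_insert_of_mem hW)) ?_
    obtain ⟨k, hk⟩ := exists_levee_mul V W _ rfl f (g W)
    rw [hk]
    refine leveeSpan_mul_mem (q := fun _ => True) hp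
      (levee_mem_leveeSpan (hU W (Finset.mem_insert_self W U)) k) ?_
    rw [← SetLike.mem_coe, ← coe_commResolventAlgebra, SetLike.mem_coe]
    exact prod_mem fun W _ => sub_mem (one_mem _) (levee_mem_commResolventAlgebra W _)

/-- Levees over subspaces with pairwise joins satisfying `p` are orthogonal modulo `leveeSpan p`,
so the norm of their sum there is at most the largest of their norms. -/
theorem exists_norm_sum_levee_sub_le {p : Submodule ℝ X → Prop}
    (hp : ∀ V W, V ≤ W → p V → p W) (T : Finset (Submodule ℝ X))
    (hT : ∀ V ∈ T, ∀ W ∈ T, W ≠ V → p (V ⊔ W)) (g : (V : Submodule ℝ X) → C₀(V, ℂ)) {M : ℝ}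
    (hM : 0 < M) (hg : ∀ V ∈ T, ‖g V‖ ≤ M) :
    ∃ ξ ∈ leveeSpan p, ‖∑ V ∈ T, levee V (g V) - ξ‖ ≤ M := by
  classical
  -- Chosen so that `T.card` terms of size at most `ε` add up to at most `M`; the `+ 1` covers empty
  -- `T`.
  have hε : 0 < M / (T.card + 1) := by positivity
  set ε : ℝ := M / (T.card + 1) with hε_def
  let h : Submodule ℝ X → (X →ᵇ ℂ) := fun V => ∏ W ∈ T.erase V, (1 - levee W (cutoff ε (g W)))
  refine ⟨∑ V ∈ T, (levee V (g V) - levee V (g V) * h V), sum_mem fun V hV =>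
    mul_prod_one_sub_levee_mem hp (g V) (fun W => cutoff ε (g W)) _ fun W hW =>
      hT V hV W (Finset.mem_of_mem_erase hW) (Finset.ne_of_mem_erase hW), ?_⟩
  rw [← Finset.sum_sub_distrib]
  simp only [sub_sub_cancel]
  refine (BoundedContinuousFunction.norm_le hM.le).2 fun y => ?_
  rw [BoundedContinuousFunction.coe_sum, Finset.sum_apply]
  have hh : ∀ V, h V y = ∏ W ∈ T.erase V, (1 - levee W (cutoff ε (g W)) y) := by
    intro V
    rw [BoundedContinuousFunction.coe_prod, Finset.prod_apply]
    rfl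
  have hle : ∀ V, ‖(levee V (g V) * h V) y‖ ≤ ‖levee V (g V) y‖ := by
    intro V
    rw [BoundedContinuousFunction.mul_apply, norm_mul]
    refine mul_le_of_le_one_right (norm_nonneg _) ?_
    rw [hh, norm_prod]
    exact Finset.prod_le_one (fun _ _ => norm_nonneg _) fun W _ =>
      norm_one_sub_cutoff_le hε (g W) _
  -- If the levee over `V` is at least `ε` at `y`, its cutoff is `1` there and annihilates every
  -- other term. Otherwise all terms are small.
  by_cases hbig : ∃ V ∈ T, ε ≤ ‖levee V (g V) y‖
  · obtain ⟨V, hV, hVy⟩ := hbig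
    rw [Finset.sum_eq_single V]
    · exact (hle V).trans ((norm_apply_le V (g V) _).trans (hg V hV))
    · intro W _ hWV
      rw [BoundedContinuousFunction.mul_apply, hh]
      refine mul_eq_zero_of_right _
        (Finset.prod_eq_zero (Finset.mem_erase.2 ⟨hWV.symm, hV⟩) ?_)
      rw [levee_apply, cutoff_apply_of_le hε (g V) (by rwa [levee_apply] at hVy), sub_self]
    · exact fun h => absurd hV h
  · push Not at hbig
    calc ‖∑ V ∈ T, (levee V (g V) * h V) y‖
        ≤ ∑ V ∈ T, ε := norm_sum_le_of_le _ fun V hV => (hle V).trans (hbig V hV).le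
      _ = T.card * ε := by rw [Finset.sum_const, nsmul_eq_mul]
      _ ≤ M := by
        rw [hε_def, mul_div_assoc', div_le_iff₀ (by positivity)]
        nlinarith

end Orthogonality

/-! ### The nullity filtration and its finite sums -/

section Chain

variable {m : ℕ}

variable (m) in
/-- The closed span of the levees of nullity at most `r`. -/
def nullityLevel (r : ℕ) : Submodule ℂ (E m →ᵇ ℂ) :=
  leveeSpan fun V : Submodule ℝ (E m) => m ≤ Module.finrank ℝ V + r

theorem nullityLevel_mono {r s : ℕ} (h : r ≤ s) : nullityLevel m r ≤ nullityLevel m s :=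
  leveeSpan_mono fun V hV => by omega

theorem nullity_upward {r : ℕ} (V W : Submodule ℝ (E m)) (h : V ≤ W)
    (hV : m ≤ Module.finrank ℝ V + r) : m ≤ Module.finrank ℝ W + r := by
  have := Submodule.finrank_mono h
  omega

theorem nullityLevel_le_not_le {r : ℕ} {V : Submodule ℝ (E m)}
    (hV : Module.finrank ℝ V + (r + 1) = m) :
    nullityLevel m r ≤ leveeSpan fun W : Submodule ℝ (E m) => ¬ W ≤ V :=
  leveeSpan_mono fun W hW h => by
    have := Submodule.finrank_mono h
    omega

theorem not_le_of_finrank_eq {V W : Submodule ℝ (E m)}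
    (h : Module.finrank ℝ V = Module.finrank ℝ W) (hne : W ≠ V) : ¬ W ≤ V := fun hle =>
  hne (Submodule.eq_of_le_of_finrank_eq hle h.symm)

theorem nullity_sup {r : ℕ} {V W : Submodule ℝ (E m)}
    (hV : Module.finrank ℝ V + (r + 1) = m) (hW : Module.finrank ℝ W + (r + 1) = m)
    (hne : W ≠ V) : m ≤ Module.finrank ℝ (V ⊔ W : Submodule ℝ (E m)) + r := by
  have hlt : V < V ⊔ W := by
    refine lt_of_le_of_ne le_sup_left fun h => ?_
    exact not_le_of_finrank_eq (by omega) hne (sup_eq_left.1 h.symm)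
  have := Submodule.finrank_lt_finrank_of_lt hlt
  omega

/-- `f` is the finite sum of the levees with coefficients `g`, all of nullity `r + 1`, modulo the
levees of nullity at most `r`. -/
structure IsFiniteLeveeSum (r : ℕ) (f : E m →ᵇ ℂ) (T : Finset (Submodule ℝ (E m)))
    (g : (V : Submodule ℝ (E m)) → C₀(V, ℂ)) : Prop where
  finrank_add : ∀ V ∈ T, Module.finrank ℝ V + (r + 1) = m
  eq_zero : ∀ V, V ∉ T → g V = 0
  sub_mem : f - ∑ V ∈ T, levee V (g V) ∈ nullityLevel m r

/-- Vanishing of the coefficients off `T` lets different finite sums be compared over a common index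
set. -/
theorem IsFiniteLeveeSum.sum_superset {r : ℕ} {f : E m →ᵇ ℂ} {T U : Finset (Submodule ℝ (E m))}
    {g : (V : Submodule ℝ (E m)) → C₀(V, ℂ)} (h : IsFiniteLeveeSum r f T g) (hTU : T ⊆ U) :
    ∑ V ∈ T, levee V (g V) = ∑ V ∈ U, levee V (g V) :=
  Finset.sum_subset hTU fun V _ hV => by rw [h.eq_zero V hV, levee_zero]

open Classical in
theorem IsFiniteLeveeSum.add {r : ℕ} {f₁ f₂ : E m →ᵇ ℂ} {T₁ T₂ : Finset (Submodule ℝ (E m))}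
    {g₁ g₂ : (V : Submodule ℝ (E m)) → C₀(V, ℂ)} (h₁ : IsFiniteLeveeSum r f₁ T₁ g₁)
    (h₂ : IsFiniteLeveeSum r f₂ T₂ g₂) :
    IsFiniteLeveeSum r (f₁ + f₂) (T₁ ∪ T₂) fun V => g₁ V + g₂ V where
  finrank_add V hV := (Finset.mem_union.1 hV).elim (h₁.finrank_add V) (h₂.finrank_add V)
  eq_zero V hV := by
    rw [Finset.mem_union, not_or] at hV
    rw [h₁.eq_zero V hV.1, h₂.eq_zero V hV.2, add_zero]
  sub_mem := by
    simp only [levee_add, Finset.sum_add_distrib]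
    rw [← h₁.sum_superset Finset.subset_union_left, ← h₂.sum_superset Finset.subset_union_right,
      add_sub_add_comm]
    exact add_mem h₁.sub_mem h₂.sub_mem

theorem IsFiniteLeveeSum.smul {r : ℕ} {f : E m →ᵇ ℂ} {T : Finset (Submodule ℝ (E m))}
    {g : (V : Submodule ℝ (E m)) → C₀(V, ℂ)} (c : ℂ) (h : IsFiniteLeveeSum r f T g) :
    IsFiniteLeveeSum r (c • f) T fun V => c • g V where
  finrank_add := h.finrank_add
  eq_zero V hV := by rw [h.eq_zero V hV, smul_zero]
  sub_mem := by
    simp only [levee_smul]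
    rw [← Finset.smul_sum, ← smul_sub]
    exact Submodule.smul_mem _ c h.sub_mem

theorem IsFiniteLeveeSum.sub {r : ℕ} {f₁ f₂ : E m →ᵇ ℂ} {T₁ T₂ : Finset (Submodule ℝ (E m))}
    {g₁ g₂ : (V : Submodule ℝ (E m)) → C₀(V, ℂ)} (h₁ : IsFiniteLeveeSum r f₁ T₁ g₁)
    (h₂ : IsFiniteLeveeSum r f₂ T₂ g₂) :
    ∃ T, IsFiniteLeveeSum r (f₁ - f₂) T fun V => g₁ V - g₂ V := by
  have h := h₁.add (h₂.smul (-1))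
  have hg : (fun V => g₁ V + (-1 : ℂ) • g₂ V) = fun V => g₁ V - g₂ V := by
    funext V
    ext v
    change g₁ V v + (-1 : ℂ) * g₂ V v = g₁ V v - g₂ V v
    ring
  rw [hg, neg_smul, one_smul, ← sub_eq_add_neg] at h
  exact ⟨_, h⟩

/-- The coefficients of nullity `r + 1` are bounded by the norm. -/
theorem IsFiniteLeveeSum.norm_coeff_le {r : ℕ} {f : E m →ᵇ ℂ} {T : Finset (Submodule ℝ (E m))}
    {g : (V : Submodule ℝ (E m)) → C₀(V, ℂ)} (h : IsFiniteLeveeSum r f T g)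
    (V : Submodule ℝ (E m)) : ‖g V‖ ≤ ‖f‖ := by
  classical
  by_cases hV : V ∈ T
  -- Apart from the term at `V`, only levees over subspaces not contained in `V` remain.
  · have hmem : f - levee V (g V) ∈ leveeSpan fun W : Submodule ℝ (E m) => ¬ W ≤ V := by
      have h1 : f - levee V (g V) = (f - ∑ W ∈ T, levee W (g W)) +
          ∑ W ∈ T.erase V, levee W (g W) := by
        rw [← Finset.add_sum_erase T _ hV]
        abel
      rw [h1]
      refine add_mem (nullityLevel_le_not_le (h.finrank_add V hV) h.sub_mem)
        (sum_mem fun W hW => levee_mem_leveeSpan ?_ (g W))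
      have h2 := h.finrank_add V hV
      have h3 := h.finrank_add W (Finset.mem_of_mem_erase hW)
      exact not_le_of_finrank_eq (by omega) (Finset.ne_of_mem_erase hW)
    have := norm_le_norm_levee_add V (g V) hmem
    rwa [add_sub_cancel] at this
  · rw [h.eq_zero V hV, norm_zero]
    exact norm_nonneg f

open Classical in
theorem exists_isFiniteLeveeSum {r : ℕ} {f : E m →ᵇ ℂ}
    (hf : f ∈ Submodule.span ℂ {f | ∃ (V : Submodule ℝ (E m)) (g : C₀(V, ℂ)),
      m ≤ Module.finrank ℝ V + (r + 1) ∧ f = levee V g}) :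
    ∃ T g, IsFiniteLeveeSum r f T g := by
  induction hf using Submodule.span_induction with
  | mem f hf =>
    obtain ⟨V, g, hV, rfl⟩ := hf
    by_cases hV' : m ≤ Module.finrank ℝ V + r
    · refine ⟨∅, fun _ => 0, by simp, fun _ _ => rfl, ?_⟩
      rw [Finset.sum_empty, sub_zero]
      exact levee_mem_leveeSpan hV' g
    · refine ⟨{V}, Pi.single V g, fun W hW => ?_, fun W hW => ?_, ?_⟩
      · rw [Finset.mem_singleton.1 hW]
        omega
      · rw [Pi.single_eq_of_ne (by simpa using hW)]
      · rw [Finset.sum_singleton, Pi.single_eq_same, sub_self]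
        exact zero_mem _
  | zero =>
    refine ⟨∅, fun _ => 0, by simp, fun _ _ => rfl, by simp⟩
  | add f₁ f₂ _ _ h₁ h₂ =>
    obtain ⟨T₁, g₁, h₁⟩ := h₁
    obtain ⟨T₂, g₂, h₂⟩ := h₂
    exact ⟨_, _, h₁.add h₂⟩
  | smul c f _ h =>
    obtain ⟨T, g, h⟩ := h
    exact ⟨_, _, h.smul c⟩

/-! ### Unconditional sums and the identification of `C m r` -/

theorem norm_mkQ_le_of_sub_mem {N : Submodule ℂ (E m →ᵇ ℂ)} {f h : E m →ᵇ ℂ}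
    (hfh : f - h ∈ N) : ‖N.mkQ f‖ ≤ ‖h‖ := by
  have h1 : N.mkQ f = N.mkQ h := (Submodule.Quotient.eq N).2 hfh
  rw [h1]
  exact Submodule.Quotient.norm_mk_le N h

theorem norm_mkQ_sum_levee_le {r : ℕ} (T : Finset (Submodule ℝ (E m)))
    (hT : ∀ V ∈ T, Module.finrank ℝ V + (r + 1) = m)
    (g : (V : Submodule ℝ (E m)) → C₀(V, ℂ)) {M : ℝ} (hM : 0 < M) (hg : ∀ V ∈ T, ‖g V‖ ≤ M) :
    ‖(nullityLevel m r).mkQ (∑ V ∈ T, levee V (g V))‖ ≤ M := by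
  obtain ⟨ξ, hξ, h⟩ := exists_norm_sum_levee_sub_le (nullity_upward (r := r)) T
    (fun V hV W hW hne => nullity_sup (hT V hV) (hT W hW) hne) g hM hg
  refine (norm_mkQ_le_of_sub_mem ?_).trans h
  rwa [sub_sub_cancel]

/-- Coefficients of finite approximants are Cauchy, uniformly in `V`; their limits `G` are the
coefficients of `f`, supported on the countable union of the finite index sets. -/
theorem isLeveeSumMod_of_mem {r : ℕ} {f : E m →ᵇ ℂ} (hf : f ∈ nullityLevel m (r + 1)) :
    IsLeveeSumMod m (r + 1) (nullityLevel m r) f := by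
  classical
  obtain ⟨F, hFmem, hF⟩ := mem_closure_iff_seq_limit.1
    (show f ∈ closure (Submodule.span ℂ {f | ∃ (V : Submodule ℝ (E m)) (g : C₀(V, ℂ)),
      m ≤ Module.finrank ℝ V + (r + 1) ∧ f = levee V g} : Set (E m →ᵇ ℂ)) from hf)
  choose T g hTg using fun n => exists_isFiniteLeveeSum (hFmem n)
  have hdiff : ∀ n k V, ‖g n V - g k V‖ ≤ ‖F n - F k‖ := fun n k V => by
    obtain ⟨U, hU⟩ := (hTg n).sub (hTg k)
    exact hU.norm_coeff_le V
  have hlim : ∀ V : Submodule ℝ (E m), ∃ G : C₀(V, ℂ), Filter.Tendsto (fun n => g n V) Filter.atTop (𝓝 G) := by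
    intro V
    refine cauchySeq_tendsto_of_complete ?_
    rw [Metric.cauchySeq_iff]
    intro ε hε
    obtain ⟨N, hN⟩ := Metric.cauchySeq_iff.1 hF.cauchySeq ε hε
    refine ⟨N, fun n hn k hk => ?_⟩
    rw [dist_eq_norm]
    exact (hdiff n k V).trans_lt (by rw [← dist_eq_norm]; exact hN n hn k hk)
  choose G hG using hlim
  have hdiffG : ∀ n V, ‖g n V - G V‖ ≤ ‖F n - f‖ := fun n V =>
    le_of_tendsto_of_tendsto (((hG V).const_sub _).norm) ((hF.const_sub _).norm)
      (Filter.Eventually.of_forall fun k => hdiff n k V)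
  let S : Set (Submodule ℝ (E m)) := ⋃ n, (T n : Set (Submodule ℝ (E m)))
  have hS : ∀ V ∈ S, Module.finrank ℝ V + (r + 1) = m := by
    intro V hV
    obtain ⟨n, hn⟩ := Set.mem_iUnion.1 hV
    exact (hTg n).finrank_add V hn
  refine ⟨S, G, Set.countable_iUnion fun n => (T n).countable_toSet, hS, ?_⟩
  rw [HasSum, SummationFilter.unconditional_filter, Metric.tendsto_nhds]
  intro ε hε
  obtain ⟨n, hn⟩ := (Metric.tendsto_nhds.1 hF (ε / 3) (by positivity)).exists
  rw [dist_eq_norm] at hn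
  have hTS : ∀ V ∈ T n, V ∈ S := fun V hV => Set.mem_iUnion.2 ⟨n, hV⟩
  filter_upwards [Filter.eventually_ge_atTop ((T n).subtype (· ∈ S))] with U hU
  let U' : Finset (Submodule ℝ (E m)) := U.map (Function.Embedding.subtype _)
  have hU'S : ∀ V ∈ U', V ∈ S := by
    intro V hV
    obtain ⟨W, _, rfl⟩ := Finset.mem_map.1 hV
    exact W.2
  have hTU : T n ⊆ U' := by
    intro V hV
    exact Finset.mem_map.2 ⟨⟨V, hTS V hV⟩, hU (Finset.mem_subtype.2 hV), rfl⟩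
  have hsum : ∑ V ∈ U, (nullityLevel m r).mkQ (levee (V : Submodule ℝ (E m)) (G V)) =
      (nullityLevel m r).mkQ (∑ V ∈ U', levee V (G V)) := by
    rw [map_sum, Finset.sum_map]
    rfl
  -- The bound does not depend on the size of `U'`; this is what gives unconditional convergence.
  have h1 : ‖(nullityLevel m r).mkQ (∑ V ∈ U', levee V (g n V - G V))‖ ≤ ε / 3 :=
    norm_mkQ_sum_levee_le U' (fun V hV => hS V (hU'S V hV)) _ (by positivity)
      fun V _ => (hdiffG n V).trans hn.le
  have h2 : (nullityLevel m r).mkQ (F n) =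
      (nullityLevel m r).mkQ (∑ V ∈ U', levee V (g n V)) := by
    rw [← (hTg n).sum_superset hTU]
    exact (Submodule.Quotient.eq _).2 (hTg n).sub_mem
  have h3 : ∑ V ∈ U', levee V (g n V) =
      ∑ V ∈ U', levee V (g n V - G V) + ∑ V ∈ U', levee V (G V) := by
    rw [← Finset.sum_add_distrib]
    refine Finset.sum_congr rfl fun V _ => ?_
    rw [← levee_add, sub_add_cancel]
  have h4 : ‖(nullityLevel m r).mkQ (F n - f)‖ ≤ ‖F n - f‖ :=
    Submodule.Quotient.norm_mk_le _ _
  rw [hsum, dist_eq_norm]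
  have h5 : (nullityLevel m r).mkQ (∑ V ∈ U', levee V (G V)) - (nullityLevel m r).mkQ f =
      (nullityLevel m r).mkQ (F n - f) -
        (nullityLevel m r).mkQ (∑ V ∈ U', levee V (g n V - G V)) := by
    rw [map_sub, h2, h3, map_add]
    abel
  rw [h5]
  linarith [norm_sub_le ((nullityLevel m r).mkQ (F n - f))
    ((nullityLevel m r).mkQ (∑ V ∈ U', levee V (g n V - G V)))]

theorem mem_of_isLeveeSumMod {r : ℕ} {f : E m →ᵇ ℂ}
    (hf : IsLeveeSumMod m (r + 1) (nullityLevel m r) f) : f ∈ nullityLevel m (r + 1) := by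
  obtain ⟨S, g, _, hS, h⟩ := hf
  have hcl : IsClosed (nullityLevel m (r + 1) : Set (E m →ᵇ ℂ)) := isClosed_leveeSpan _
  rw [← SetLike.mem_coe, ← hcl.closure_eq, Metric.mem_closure_iff]
  intro ε hε
  rw [HasSum, SummationFilter.unconditional_filter, Metric.tendsto_nhds] at h
  obtain ⟨U, hU⟩ := (h ε hε).exists
  rw [← map_sum, dist_comm, dist_eq_norm, ← map_sub] at hU
  -- A small representative `h` of the class of the remainder; `f - h` then lies in the level `r +
  -- 1` and is close to `f`.
  obtain ⟨h, hh, hlt⟩ := (QuotientAddGroup.norm_lt_iff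
    (S := (nullityLevel m r).toAddSubgroup)).1 hU
  have hmem : (f - ∑ V ∈ U, levee (V : Submodule ℝ (E m)) (g V)) - h ∈ nullityLevel m r :=
    (Submodule.Quotient.eq _).1 hh.symm
  refine ⟨f - h, ?_, by rwa [dist_eq_norm, sub_sub_cancel]⟩
  have h1 : f - h = ((f - ∑ V ∈ U, levee (V : Submodule ℝ (E m)) (g V)) - h) +
      ∑ V ∈ U, levee (V : Submodule ℝ (E m)) (g V) := by abel
  rw [h1]
  exact add_mem (nullityLevel_mono (Nat.le_succ r) hmem)
    (sum_mem fun V _ => levee_mem_leveeSpan (hS V V.2).ge _)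

theorem nullityLevel_zero : nullityLevel m 0 = vanishing m := by
  apply le_antisymm
  · refine leveeSpan_le ?_ fun V g hV => ?_
    · have h : (vanishing m : Set (E m →ᵇ ℂ)) =
          Set.range (ZeroAtInftyContinuousMap.toBCF : C₀(E m, ℂ) → E m →ᵇ ℂ) := by
        ext f
        constructor
        · exact fun hf => ⟨⟨f.toContinuousMap, hf⟩, rfl⟩
        · rintro ⟨g, rfl⟩
          exact g.zero_at_infty'
      rw [h]
      exact ZeroAtInftyContinuousMap.isClosed_range_toBCF
    · have hV' : V = ⊤ := Submodule.eq_top_of_finrank_eq (le_antisymm (Submodule.finrank_le V)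
        (by rw [finrank_euclideanSpace_fin]; exact hV))
      refine g.zero_at_infty'.comp ?_
      refine (LinearMap.isClosedEmbedding_of_injective
        (f := V.orthogonalProjectionOnto.toLinearMap) ?_).tendsto_cocompact
      rw [Submodule.ker_orthogonalProjectionOnto, hV', Submodule.top_orthogonal_eq_bot]
  · intro f hf
    have hf' : f = levee (⊤ : Submodule ℝ (E m))
        ⟨f.toContinuousMap.comp ⟨Subtype.val, continuous_subtype_val⟩,
          (show Filter.Tendsto f _ _ from hf).comp
            (Submodule.closed_of_finiteDimensional
              (⊤ : Submodule ℝ (E m))).isClosedEmbedding_subtypeVal.tendsto_cocompact⟩ := by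
      ext y
      change f y = f ((⊤ : Submodule ℝ (E m)).starProjection y)
      rw [Submodule.starProjection_eq_self_iff.2 Submodule.mem_top]
    rw [hf']
    refine levee_mem_leveeSpan ?_ _
    rw [finrank_top, finrank_euclideanSpace_fin]
    rfl

/-- Closedness of `C m r`, which its definition does not assert, comes from this identification. -/
theorem C_eq_nullityLevel (m r : ℕ) : C m r = nullityLevel m r := by
  induction r with
  | zero => exact nullityLevel_zero.symm
  | succ r ih =>
    ext f
    change IsLeveeSumMod m (r + 1) (C m r) f ↔ _
    rw [ih]
    exact ⟨mem_of_isLeveeSumMod, isLeveeSumMod_of_mem⟩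

/-! ### The strict chain of closed ideals -/

variable (m) in
theorem nullityLevel_self :
    (nullityLevel m m : Set (E m →ᵇ ℂ)) = commResolventAlgebra (E m) := by
  rw [coe_commResolventAlgebra, nullityLevel]
  simp only [le_add_iff_nonneg_left, zero_le]

theorem exists_zeroAtInfty_ne_zero (V : Submodule ℝ (E m)) : ∃ g : C₀(V, ℂ), g ≠ 0 := by
  obtain ⟨s, hs⟩ := Module.Finite.iff_fg.1 (inferInstance : FiniteDimensional ℝ V)
  obtain ⟨p, hp⟩ := exists_prod_resolventFun_eq_levee s V hs
  refine ⟨p, fun h => ?_⟩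
  have h0 : p 0 ≠ 0 := by
    rw [← levee_apply_coe, ← hp, BoundedContinuousFunction.coe_prod, Finset.prod_apply,
      Finset.prod_ne_zero_iff]
    exact fun x _ => one_div_ne_zero (resolvent_denom_ne_zero one_ne_zero _)
  exact h0 (by rw [h]; rfl)

theorem exists_submodule_finrank_eq {d : ℕ} (hd : d ≤ m) :
    ∃ V : Submodule ℝ (E m), Module.finrank ℝ V = d := by
  obtain ⟨f, hf⟩ := exists_linearIndependent_of_le_finrank (R := ℝ) (M := E m) (n := d)
    (by rwa [finrank_euclideanSpace_fin])
  exact ⟨Submodule.span ℝ (Set.range f), by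
    rw [finrank_span_eq_card hf, Fintype.card_fin]⟩

theorem nullityLevel_lt {r : ℕ} (hr : r < m) : nullityLevel m r < nullityLevel m (r + 1) := by
  refine lt_of_le_not_ge (nullityLevel_mono (Nat.le_succ r)) fun hle => ?_
  obtain ⟨V, hV⟩ := exists_submodule_finrank_eq (m := m) (Nat.sub_le m (r + 1))
  obtain ⟨g, hg⟩ := exists_zeroAtInfty_ne_zero V
  have hV' : Module.finrank ℝ V + (r + 1) = m := by omega
  have h1 : levee V g ∈ nullityLevel m r := hle (levee_mem_leveeSpan hV'.ge g)
  -- Subtracting the levee from itself is an admissible perturbation if it lies in the level `r`,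
  -- which forces `‖g‖ ≤ 0`.
  have h2 := norm_le_norm_levee_add V g (neg_mem (nullityLevel_le_not_le hV' h1))
  rw [add_neg_cancel, norm_zero] at h2
  exact hg (norm_le_zero_iff.1 h2)

theorem nullityLevel_le_commResolventAlgebra {r : ℕ} {f : E m →ᵇ ℂ}
    (hf : f ∈ nullityLevel m r) : f ∈ commResolventAlgebra (E m) := by
  rw [← SetLike.mem_coe, coe_commResolventAlgebra]
  exact leveeSpan_mono (fun _ _ => trivial) hf

variable (m) in
/-- The levees of nullity at most `r` span a closed ideal in the commutative resolvent algebra. -/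
def nullityIdeal (r : ℕ) : Ideal (commResolventAlgebra (E m)) where
  carrier := Subtype.val ⁻¹' (nullityLevel m r : Set (E m →ᵇ ℂ))
  zero_mem' := zero_mem (nullityLevel m r)
  add_mem' := fun {a b} ha hb => (nullityLevel m r).add_mem ha hb
  smul_mem' := fun c a ha => by
    have hc : (c : E m →ᵇ ℂ) ∈ leveeSpan fun _ : Submodule ℝ (E m) => True := by
      rw [← SetLike.mem_coe, ← coe_commResolventAlgebra]
      exact c.2
    have h := leveeSpan_mul_mem (nullity_upward (r := r)) ha hc
    rw [mul_comm] at h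
    exact h

end Chain

end CommResolvent

end

theorem mainTheorem4 (m : ℕ) :
    (CommResolvent.commResolventAlgebra (CommResolvent.E m) : Set (CommResolvent.E m →ᵇ ℂ))
        = (CommResolvent.C m m : Set (CommResolvent.E m →ᵇ ℂ)) ∧
    (∀ r : ℕ, r < m → CommResolvent.C m r < CommResolvent.C m (r + 1)) ∧
    (∀ r : ℕ, r ≤ m →
      ∃ I : Ideal (CommResolvent.commResolventAlgebra (CommResolvent.E m)),
        IsClosed (I : Set (CommResolvent.commResolventAlgebra (CommResolvent.E m))) ∧
        (Subtype.val '' (I : Set (CommResolvent.commResolventAlgebra (CommResolvent.E m))) :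
            Set (CommResolvent.E m →ᵇ ℂ))
          = (CommResolvent.C m r : Set (CommResolvent.E m →ᵇ ℂ))) := by
  simp only [CommResolvent.C_eq_nullityLevel]
  refine ⟨(CommResolvent.nullityLevel_self m).symm, fun r hr => CommResolvent.nullityLevel_lt hr,
    fun r _ => ⟨CommResolvent.nullityIdeal m r,
      (CommResolvent.isClosed_leveeSpan _).preimage continuous_subtype_val, ?_⟩⟩
  ext f
  constructor
  · rintro ⟨a, ha, rfl⟩
    exact ha
  · exact fun hf => ⟨⟨f, CommResolvent.nullityLevel_le_commResolventAlgebra hf⟩, hf, rfl⟩
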